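/- Let $F$ be an infinite field and let $F\langle a,b,x\rangle$ be the free associative $F$-algebra on $a,b,x$, graded by $\deg a=\deg b=1$, $\deg x=0$. Let $R$ be the (non-unital) subalgebra generated by $a,b$, let $A$ be the (non-unital) subalgebra generated by all $ax^i,bx^i$ ($i\ge 0$), let $A(n)$ be the set of elements of $A$ that are homogeneous of degree $n$ (including $0$), and let $\langle x\rangle$ be the two-sided ideal of $F\langle a,b,x\rangle$ generated by $x$. For $t\in F$ let $\gamma_t$ be the $F$-algebra endomorphism of $F\langle a,b,x\rangle$ with $\gamma_t(a)=a$, $\gamma_t(b)=b$, $\gamma_t(x)=x+t$, applied to matrices entrywise. For a square matrix $N$ over $F\langle a,b,x\rangle$ let $L(N)$ be the $F$-space of matrices spanned by all $\gamma_t(N)$, $t\in F$; for an $F$-space $V$ of matrices let $S(V)\subseteq F\langle a,b,x\rangle$ be the $F$-space spanned by all entries of all matrices in $V$. Let $M$ be a $d\times d$ matrix of the form $M=\sum_{i=1}^{\xi}A_i a_i$ with $\xi\ge 1$, where 1. $A_1,\dots,A_\xi$ are $d\times d$ matrices with entries in $F$, and $a_1,\dots,a_\xi$ are $F$-linearly independent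 elements of $A(\alpha)\cap\langle x\rangle$ for some $\alpha>0$; 2. if $H$ denotes the (not necessarily unital) $F$-algebra generated by $A_1,\dots,A_\xi$ and $W$ its Wedderburn radical, i.e. the largest nilpotent ideal of $H$, then $e=A_1$ satisfies $e^2=e$, and $r-er\in W$ and $r-re\in W$ for every $r\in H$. Then for every natural number $c$ there is a natural number $m>c$ such that $R\cap S(L(M^m))$ is a finite-dimensional $F$-space with $$\dim_F\bigl(R\cap S(L(M^m))\bigr)<\sqrt m .$$ -/

import Mathlib

namespace DiffPoly

/-- The three free generators. -/
inductive Gen where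
  | a
  | b
  | x

/-- The free noncommutative algebra `F⟨a, b, x⟩` (with identity). -/
abbrev FreeAlg (F : Type*) [Field F] : Type _ := FreeAlgebra F Gen

section Algebra

variable (F : Type*) [Field F]

/-- The generator `a` as an element of the free algebra. -/
def genA : FreeAlg F := FreeAlgebra.ι F Gen.a

/-- The generator `b` as an element of the free algebra. -/
def genB : FreeAlg F := FreeAlgebra.ι F Gen.b

/-- The generator `x` as an element of the free algebra. -/
def genX : FreeAlg F := FreeAlgebra.ι F Gen.x

/-- `a` and `b` have degree one, `x` has degree zero. -/
def Gen.deg : Gen → ℕ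
  | Gen.a => 1
  | Gen.b => 1
  | Gen.x => 0

/-- The span of the monomials of degree `n`, that is, of those monomials in which `a` and `b`
together occur exactly `n` times. -/
def degreePart (n : ℕ) : Submodule F (FreeAlg F) :=
  Submodule.span F
    {w | ∃ l : List Gen, (l.map Gen.deg).sum = n ∧ w = (l.map (FreeAlgebra.ι F)).prod}

/-- The subalgebra `R` (without identity) generated by `a` and `b`. -/
def algR : NonUnitalSubalgebra F (FreeAlg F) :=
  NonUnitalAlgebra.adjoin F {genA F, genB F}

/-- The subalgebra `A` (without identity) generated by all `a x ^ i` and `b x ^ i`, `i ≥ 0`. -/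
def algA : NonUnitalSubalgebra F (FreeAlg F) :=
  NonUnitalAlgebra.adjoin F
    {w | ∃ i : ℕ, w = genA F * genX F ^ i ∨ w = genB F * genX F ^ i}

/-- The homogeneous component `A(n)` of `A`. -/
def algAPart (n : ℕ) : Submodule F (FreeAlg F) :=
  (algA F).toSubmodule ⊓ degreePart F n

/-- The two-sided ideal `⟨x⟩` of the free algebra. -/
def idealX : TwoSidedIdeal (FreeAlg F) := TwoSidedIdeal.span {genX F}

variable {F}

/-- The homomorphism `γ_t` with `a ↦ a`, `b ↦ b`, `x ↦ x + t`. -/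
def gamma (t : F) : FreeAlg F →ₐ[F] FreeAlg F :=
  FreeAlgebra.lift F fun g : Gen =>
    match g with
    | Gen.a => genA F
    | Gen.b => genB F
    | Gen.x => genX F + algebraMap F (FreeAlg F) t

/-- `L(M)`: the space of matrices spanned by all `γ_t(M)`, `t ∈ F`
(with `γ_t` applied to each entry). -/
def spaceL {d : ℕ} (M : Matrix (Fin d) (Fin d) (FreeAlg F)) :
    Submodule F (Matrix (Fin d) (Fin d) (FreeAlg F)) :=
  Submodule.span F (Set.range fun t : F => M.map (gamma t))

/-- `S(V)`: the space spanned by all entries of all the matrices in `V`. -/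
def spaceS {d : ℕ} (V : Submodule F (Matrix (Fin d) (Fin d) (FreeAlg F))) :
    Submodule F (FreeAlg F) :=
  Submodule.span F {z | ∃ N ∈ V, ∃ i j : Fin d, z = N i j}

end Algebra

section Radical

variable {F B : Type*} [Field F] [Ring B] [Algebra F B]

/-- `J` is a nilpotent two-sided ideal of the algebra `H`, where `H` (which need not contain the
identity of `B`) is a subalgebra of `B`. -/
structure IsNilpotentIdeal (H : NonUnitalSubalgebra F B) (J : Submodule F B) : Prop where
  le : J ≤ H.toSubmodule
  mul_left_mem : ∀ h ∈ H, ∀ j ∈ J, h * j ∈ J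
  mul_right_mem : ∀ h ∈ H, ∀ j ∈ J, j * h ∈ J
  nilpotent : ∃ s : ℕ, J ^ s = ⊥

/-- The Wedderburn radical of `H`; when `B` is finite-dimensional it is the largest nilpotent
ideal of `H`, see `isGreatest_wedderburnRadical`. -/
def wedderburnRadical (H : NonUnitalSubalgebra F B) : Submodule F B :=
  sSup {J | IsNilpotentIdeal H J}

theorem IsNilpotentIdeal.sup {H : NonUnitalSubalgebra F B} {J K : Submodule F B}
    (hJ : IsNilpotentIdeal H J) (hK : IsNilpotentIdeal H K) : IsNilpotentIdeal H (J ⊔ K) := by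
  refine ⟨sup_le hJ.le hK.le, ?_, ?_, ?_⟩
  · intro h hh j hj
    obtain ⟨u, hu, v, hv, rfl⟩ := Submodule.mem_sup.1 hj
    rw [mul_add]
    exact Submodule.add_mem_sup (hJ.mul_left_mem h hh u hu) (hK.mul_left_mem h hh v hv)
  · intro h hh j hj
    obtain ⟨u, hu, v, hv, rfl⟩ := Submodule.mem_sup.1 hj
    rw [add_mul]
    exact Submodule.add_mem_sup (hJ.mul_right_mem h hh u hu) (hK.mul_right_mem h hh v hv)
  · obtain ⟨s, hs⟩ := hJ.nilpotent
    obtain ⟨t, ht⟩ := hK.nilpotent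
    have hJK : J * K ≤ K := Submodule.mul_le.2 fun u hu v hv => hK.mul_left_mem u (hJ.le hu) v hv
    have hKJ : K * J ≤ K := Submodule.mul_le.2 fun u hu v hv => hK.mul_right_mem v (hJ.le hv) u hu
    have hKK : K * K ≤ K := Submodule.mul_le.2 fun u hu v hv => hK.mul_left_mem u (hK.le hu) v hv
    have hpow : ∀ n : ℕ, J ^ n * K ≤ K := by
      intro n
      induction n with
      | zero => simp
      | succ n ih =>
        rw [pow_succ, mul_assoc]
        exact (mul_le_mul' le_rfl hJK).trans ih
    have key : ∀ n : ℕ, (J ⊔ K) ^ n ≤ J ^ n ⊔ K := by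
      intro n
      induction n with
      | zero => simp
      | succ n ih =>
        rw [pow_succ]
        refine (mul_le_mul' ih le_rfl).trans ?_
        rw [Submodule.sup_mul, Submodule.mul_sup, Submodule.mul_sup, ← pow_succ]
        exact sup_le (sup_le le_sup_left ((hpow n).trans le_sup_right))
          ((sup_le hKJ hKK).trans le_sup_right)
    refine ⟨s * t, ?_⟩
    have h1 : (J ⊔ K) ^ s ≤ K := by
      have := key s
      rwa [hs, bot_sup_eq] at this
    rw [pow_mul, eq_bot_iff, ← ht]
    exact pow_le_pow_left' h1 t

theorem isGreatest_wedderburnRadical [FiniteDimensional F B] (H : NonUnitalSubalgebra F B) :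
    IsGreatest {J | IsNilpotentIdeal H J} (wedderburnRadical H) := by
  refine ⟨?_, fun J hJ => le_sSup hJ⟩
  refine CompleteLattice.WellFoundedGT.isSupClosedCompact (Submodule F B) inferInstance _
    ⟨⊥, ⟨bot_le, ?_, ?_, 1, pow_one _⟩⟩ ?_
  · intro h _ j hj
    rw [Submodule.mem_bot] at hj ⊢
    rw [hj, mul_zero]
  · intro h _ j hj
    rw [Submodule.mem_bot] at hj ⊢
    rw [hj, zero_mul]
  · intro J hJ K hK
    exact IsNilpotentIdeal.sup hJ hK

end Radical

/-- `M = ∑ i, A i * a i` for scalar matrices `A i` and linearly independent elements `a i` of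
`A(α) ∩ ⟨x⟩`, for some `α > 0`, such that the first of the scalar matrices is an idempotent which
acts from both sides as an identity on `H` modulo the Wedderburn radical of `H`, where `H` is the
algebra (without identity in general) generated by the matrices `A i`.
The number of summands is `ξ + 1`, and they are numbered from `0`. -/
def HasIdempotentPresentation {F : Type*} [Field F] {d : ℕ}
    (M : Matrix (Fin d) (Fin d) (FreeAlg F)) : Prop :=
  ∃ (ξ α : ℕ) (A : Fin (ξ + 1) → Matrix (Fin d) (Fin d) F) (a : Fin (ξ + 1) → FreeAlg F),
    M = ∑ i, (A i).map (fun c : F => c • a i) ∧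
    LinearIndependent F a ∧
    0 < α ∧
    (∀ i, a i ∈ algAPart F α ∧ a i ∈ idealX F) ∧
    A 0 * A 0 = A 0 ∧
    ∀ r ∈ NonUnitalAlgebra.adjoin F (Set.range A),
      r - A 0 * r ∈ wedderburnRadical (NonUnitalAlgebra.adjoin F (Set.range A)) ∧
      r - r * A 0 ∈ wedderburnRadical (NonUnitalAlgebra.adjoin F (Set.range A))

end DiffPoly

namespace DiffPoly

open Polynomial

/-! ### Dimension counts for images and products of subspaces. -/

section LinearAlgebra

variable {F V V' : Type*} [Field F] [AddCommGroup V] [Module F V] [AddCommGroup V'] [Module F V']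

/-! The dimension is in fact bounded by a constant `b` for infinitely many `m`; taking `m > b ^ 2`
finishes the proof.

Every word in `γ_t(M) ^ m` factors uniquely into `m` blocks of degree `α` starting with `a` or `b`.
Its coefficient is therefore a product of `m` matrix polynomials in `t`, one for each block. Let `P`
be the span of the polynomials of single blocks, so that `P ^ m` is the span of those of all words
of `m` blocks, and let `Q m` be the span of those of words containing `x`. An element of `S(L(M ^
m))` comes from a functional on polynomials whose values are its word coefficients. If the element
lies in `R`, the functional kills `Q m`; so `P ^ m ≤ Q m ⊔ D` bounds the dimension by that of `D`
(`finrank_algR_inf_le`).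

To find a small `D`, note that the `a i` are independent and lie in `⟨x⟩`, so blocks containing `x`
yield `q ∈ P` with constant term `e = A 0`, and `q P ^ n ⊆ Q (n + 1)`. Modulo the radical,
multiplication by `q` loses no dimension, while `dim P ^ n` grows at most linearly in `n`. Hence `q
P ^ n` has bounded codimension in `P ^ (n + 1)` for suitable `n`. The error lies one layer deeper in
the radical filtration, and nilpotency ends the descent (`exists_pow_le_sup`). -/

theorem finrank_map_le_finrank_map (X : Submodule F V) [FiniteDimensional F X] (f g : V →ₗ[F] V')
    (h : ∀ v ∈ X, f v = 0 → g v = 0) :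
    Module.finrank F (X.map g) ≤ Module.finrank F (X.map f) := by
  have hf := (f.domRestrict X).finrank_range_add_finrank_ker
  have hg := (g.domRestrict X).finrank_range_add_finrank_ker
  have hker : LinearMap.ker (f.domRestrict X) ≤ LinearMap.ker (g.domRestrict X) := by
    rintro ⟨v, hv⟩ h0
    exact h v hv h0
  have hle := Submodule.finrank_mono hker
  rw [LinearMap.range_domRestrict] at hf hg
  omega

/-- If the image of `X` under `φ` has codimension at most `b` in the image of `Y`, then up to the
kernel of `φ` and a space of dimension at most `b`, the space `Y` is contained in `X`. -/
theorem exists_le_sup_sup_ker (X Y : Submodule F V) [FiniteDimensional F Y] (hXY : X ≤ Y)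
    (φ : V →ₗ[F] V') (b : ℕ)
    (h : Module.finrank F (Y.map φ) ≤ Module.finrank F (X.map φ) + b) :
    ∃ C : Submodule F V, FiniteDimensional F C ∧ Module.finrank F C ≤ b ∧
      Y ≤ X ⊔ C ⊔ (Y ⊓ LinearMap.ker φ) := by
  obtain ⟨D, hD⟩ := Submodule.exists_isCompl ((X.map φ).comap (Y.map φ).subtype)
  set ψ : Y →ₗ[F] Y.map φ := φ.submoduleMap Y with hψ
  obtain ⟨σ, hσ⟩ := LinearMap.exists_rightInverse_of_surjective ψ
    (LinearMap.range_eq_top.2 (φ.submoduleMap_surjective Y))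
  have hσ' : ∀ y : Y.map φ, φ (σ y : V) = y := fun y => by
    have := LinearMap.congr_fun hσ y
    simpa [hψ] using congrArg Subtype.val this
  have hX : Module.finrank F ((X.map φ).comap (Y.map φ).subtype) = Module.finrank F (X.map φ) :=
    (Submodule.comapSubtypeEquivOfLe (Submodule.map_mono hXY)).finrank_eq
  have hsum := Submodule.finrank_add_eq_of_isCompl hD
  -- The witness lifts, along a section of `φ` on `Y`, a complement of the image of `X` in the image
  -- of `Y`.
  refine ⟨D.map (Y.subtype ∘ₗ σ), inferInstance, ?_, ?_⟩
  · exact (Submodule.finrank_map_le _ _).trans (by omega)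
  · intro y hy
    have htop : (⟨φ y, Submodule.mem_map_of_mem hy⟩ : Y.map φ) ∈
        (X.map φ).comap (Y.map φ).subtype ⊔ D := by
      rw [hD.sup_eq_top]; trivial
    obtain ⟨u, hu, w, hw, huw⟩ := Submodule.mem_sup.1 htop
    obtain ⟨x, hx, hxu⟩ := hu
    have huw' : (u : V') + w = φ y := congrArg Subtype.val huw
    have hy' : y = x + (σ w : V) + (y - x - σ w) := by abel
    rw [hy']
    refine Submodule.add_mem_sup (Submodule.add_mem_sup hx ⟨w, hw, rfl⟩) ⟨?_, ?_⟩
    · exact Y.sub_mem (Y.sub_mem hy (hXY hx)) (σ w).2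
    · change φ _ = 0
      have hxu' : φ x = u := hxu
      rw [map_sub, map_sub, hσ', hxu', ← huw']
      abel

theorem finrank_mul_le {S : Type*} [Ring S] [Algebra F S] (P C : Submodule F S)
    [FiniteDimensional F P] [FiniteDimensional F C] :
    Module.finrank F (P * C : Submodule F S) ≤ Module.finrank F P * Module.finrank F C := by
  rw [← Submodule.mulMap_range, ← Module.finrank_tensorProduct]
  exact LinearMap.finrank_range_le _

end LinearAlgebra

/-! ### Sequences of linear growth. -/

section Pigeonhole

/-- A sequence of linear growth has bounded increments over infinitely many windows of
a given length. -/
theorem exists_bounded_window (f : ℕ → ℕ) (s a c₀ : ℕ)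
    (hlin : ∀ n, f n ≤ a * n + c₀) (c : ℕ) :
    ∃ n, c < n ∧ f (n + s) ≤ f n + a * s := by
  by_contra! hcon
  have key : ∀ k, (a * s + 1) * k ≤ f (c + 1 + s * k) := by
    intro k
    induction k with
    | zero => simp
    | succ k ih =>
      have := hcon (c + 1 + s * k) (by nlinarith [Nat.zero_le (s * k)])
      rw [show c + 1 + s * (k + 1) = c + 1 + s * k + s by ring]
      have e : (a * s + 1) * (k + 1) = (a * s + 1) * k + a * s + 1 := by ring
      omega
  -- After `k` windows the assumed growth exceeds `a * s * k` by `k`, whereas the linear bound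
  -- leaves room only for `a * (c + 1) + c₀`.
  have h1 := key (a * (c + 1) + c₀ + 1)
  have h2 := hlin (c + 1 + s * (a * (c + 1) + c₀ + 1))
  generalize hk : a * (c + 1) + c₀ + 1 = k at h1 h2
  have e1 : (a * s + 1) * k = a * s * k + k := by ring
  have e2 : a * (c + 1 + s * k) = a * s * k + a * (c + 1) := by ring
  omega

end Pigeonhole

/-! ### Powers of a space of polynomials over an algebra with a nilpotent filtration. -/

section PolynomialFiltration

variable {F B : Type*} [Field F] [Ring B] [Algebra F B]

/-- The polynomials all of whose coefficients lie in `U`. -/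
def coeffsIn (U : Submodule F B) : Submodule F B[X] where
  carrier := {p | ∀ k, p.coeff k ∈ U}
  add_mem' hp hq k := by rw [coeff_add]; exact U.add_mem (hp k) (hq k)
  zero_mem' k := by rw [coeff_zero]; exact U.zero_mem
  smul_mem' c p hp k := by rw [coeff_smul]; exact U.smul_mem c (hp k)

theorem mul_mem_coeffsIn {U : Submodule F B} {p v : B[X]}
    (h : ∀ j k, p.coeff j * v.coeff k ∈ U) : p * v ∈ coeffsIn U := fun k => by
  rw [coeff_mul]
  exact U.sum_mem fun x _ => h _ _

theorem coeffsIn_bot : coeffsIn (⊥ : Submodule F B) = ⊥ := by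
  rw [eq_bot_iff]
  intro p hp
  rw [Submodule.mem_bot]
  ext k
  simpa using hp k

/-- The polynomials of degree less than `n`, as an `F`-space. -/
noncomputable def polysLT (F B : Type*) [Field F] [Ring B] [Algebra F B] (n : ℕ) : Submodule F B[X] :=
  (degreeLT B n).restrictScalars F

theorem mem_polysLT {n : ℕ} {p : B[X]} : p ∈ polysLT F B n ↔ ∀ k, n ≤ k → p.coeff k = 0 := by
  rw [polysLT, Submodule.restrictScalars_mem, mem_degreeLT, degree_lt_iff_coeff_zero]

theorem polysLT_injective (n : ℕ) : Function.Injective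
    ((LinearMap.pi fun i : Fin n => (lcoeff B i).restrictScalars F).domRestrict
      (polysLT F B n)) := by
  rw [← LinearMap.ker_eq_bot, eq_bot_iff]
  rintro ⟨p, hp⟩ h0
  rw [Submodule.mem_bot, Subtype.ext_iff]
  ext k
  by_cases hk : k < n
  · exact congrFun h0 ⟨k, hk⟩
  · simpa using mem_polysLT.1 hp k (by omega)

instance [FiniteDimensional F B] (n : ℕ) : FiniteDimensional F (polysLT F B n) :=
  FiniteDimensional.of_injective _ (polysLT_injective n)

theorem finrank_polysLT_le [FiniteDimensional F B] (n : ℕ) :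
    Module.finrank F (polysLT F B n) ≤ n * Module.finrank F B := by
  refine (LinearMap.finrank_le_finrank_of_injective (polysLT_injective n)).trans ?_
  rw [Module.finrank_pi_fintype]
  simp

/-- Degrees at most `K` add up to at most `K * n`. This is the source of the linear growth of `dim P
^ n`. -/
theorem pow_le_polysLT {P : Submodule F B[X]} {K : ℕ} (hP : P ≤ polysLT F B (K + 1)) (n : ℕ) :
    P ^ n ≤ polysLT F B (K * n + 1) := by
  induction n with
  | zero =>
    rw [pow_zero, Submodule.one_le, mem_polysLT]
    intro k hk
    rw [coeff_one, if_neg (by omega)]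
  | succ n ih =>
    rw [pow_succ, Submodule.mul_le]
    intro u hu v hv
    rw [mem_polysLT]
    intro k hk
    rw [coeff_mul]
    refine Finset.sum_eq_zero fun x hx => ?_
    rw [Finset.HasAntidiagonal.mem_antidiagonal] at hx
    have e : K * (n + 1) = K * n + K := by ring
    rcases le_or_gt (K * n + 1) x.1 with h | h
    · rw [mem_polysLT.1 (ih hu) _ h, zero_mul]
    · rw [mem_polysLT.1 (hP hv) x.2 (by omega), mul_zero]

/-- Writing `h = h * e + (h - h * e)`, the second part always moves `u` one layer deeper, so only `e
* u` has to be tested. -/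
theorem mul_mem_coeffsIn_of_idempotent_mul_mem {H U U' : Submodule F B} {e : B}
    (hHU' : ∀ h ∈ H, ∀ u ∈ U', h * u ∈ U')
    (hcomp : ∀ h ∈ H, ∀ u ∈ U, (h - h * e) * u ∈ U') {h u : B} (hh : h ∈ H) (hu : u ∈ U)
    (heu : e * u ∈ U') : h * u ∈ U' := by
  have : h * u = h * (e * u) + (h - h * e) * u := by noncomm_ring
  rw [this]
  exact U'.add_mem (hHU' h hh _ heu) (hcomp h hh u hu)

/-- Multiplication by a polynomial with constant term `e` is injective on the part on which `e`
acts as the identity. -/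
theorem idempotent_mul_mem_coeffsIn {H U U' : Submodule F B} {e : B} (he : e * e = e) (heH : e ∈ H)
    (hHH : ∀ h ∈ H, ∀ h' ∈ H, h * h' ∈ H)
    (hHU' : ∀ h ∈ H, ∀ u ∈ U', h * u ∈ U')
    (hcomp : ∀ h ∈ H, ∀ u ∈ U, (h - h * e) * u ∈ U')
    {q v : B[X]} (hq : q ∈ coeffsIn H) (hq0 : q.coeff 0 = e) (hv : v ∈ coeffsIn U)
    (h : C e * (q * v) ∈ coeffsIn U') : C e * v ∈ coeffsIn U' := by
  intro k
  rw [coeff_C_mul]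
  -- In the `k`-th coefficient of `e q v` the constant term of `q` contributes `e * e * v_k = e *
  -- v_k`; all other terms involve some `v_j` with `j < k`, covered by induction.
  induction k using Nat.strong_induction_on with
  | _ k ih =>
    have hk := h k
    rw [coeff_C_mul, coeff_mul, Finset.mul_sum, ← Finset.add_sum_erase _ _
      (Finset.HasAntidiagonal.mem_antidiagonal.2 (zero_add k) : ((0, k) : ℕ × ℕ) ∈ _)] at hk
    simp only [hq0, ← mul_assoc, he] at hk
    refine (U'.add_mem_iff_left (U'.sum_mem fun x hx => ?_)).1 hk
    rw [Finset.mem_erase, Finset.HasAntidiagonal.mem_antidiagonal] at hx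
    have hlt : x.2 < k := by
      rcases Nat.eq_zero_or_pos x.1 with h0 | h0
      · exact absurd (Prod.ext h0 (by simp; omega)) hx.1
      · omega
    exact mul_mem_coeffsIn_of_idempotent_mul_mem hHU' hcomp (hHH e heH _ (hq _)) (hv _)
      (ih _ hlt)

/-- Let `P` be a finite-dimensional space of polynomials over a finite-dimensional algebra, with
coefficients in a subalgebra `H`, and let `q ∈ P` have an idempotent constant term which is a right
identity of `H` modulo a nilpotent filtration. Then, for infinitely many `m`, the space `P ^ m` is
contained, up to a bounded dimension, in any left-stable sequence of spaces that contains the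
spaces `q P ^ n`. -/
theorem exists_pow_le_sup [FiniteDimensional F B] {H : Submodule F B} {U : ℕ → Submodule F B}
    {e : B} {s K : ℕ} (he : e * e = e) (heH : e ∈ H)
    (hHH : ∀ h ∈ H, ∀ h' ∈ H, h * h' ∈ H) (hU0 : U 0 = H) (hUs : U s = ⊥)
    (hHU : ∀ i, ∀ h ∈ H, ∀ u ∈ U i, h * u ∈ U i)
    (hcomp : ∀ i, ∀ h ∈ H, ∀ u ∈ U i, (h - h * e) * u ∈ U (i + 1))
    {P : Submodule F B[X]} (hPH : P ≤ coeffsIn H) (hPK : P ≤ polysLT F B (K + 1))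
    {q : B[X]} (hqP : q ∈ P) (hq0 : q.coeff 0 = e)
    {Q : ℕ → Submodule F B[X]} (hPQ : ∀ n, P * Q n ≤ Q (n + 1))
    (hqQ : ∀ n, ∀ v ∈ P ^ n, q * v ∈ Q (n + 1)) :
    ∃ b : ℕ, ∀ c : ℕ, ∃ m, c < m ∧ ∃ D : Submodule F B[X], FiniteDimensional F D ∧
      Module.finrank F D ≤ b ∧ P ^ m ≤ Q m ⊔ D := by
  have : FiniteDimensional F P := Submodule.finiteDimensional_of_le hPK
  have hfin : ∀ n, FiniteDimensional F (P ^ n : Submodule F B[X]) := fun n =>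
    Submodule.finiteDimensional_of_le (pow_le_polysLT hPK n)
  have hTH : ∀ n, 1 ≤ n → P ^ n ≤ coeffsIn H := by
    intro n hn
    induction n, hn using Nat.le_induction with
    | base => rwa [pow_one]
    | succ n _ ih =>
      rw [pow_succ, Submodule.mul_le]
      exact fun u hu v hv => mul_mem_coeffsIn fun j k => hHH _ (ih hu j) _ (hPH hv k)
  let T : ℕ → ℕ → Submodule F B[X] := fun i n => P ^ n ⊓ coeffsIn (U i)
  have : ∀ i n, FiniteDimensional F (T i n) := fun i n =>
    Submodule.finiteDimensional_of_le (inf_le_left : T i n ≤ P ^ n)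
  -- The kernel of `φ i` on `T i n` is the part that any left factor from `P` pushes into layer `i +
  -- 1`; see `hker`.
  let φ : ∀ i : ℕ, B[X] →ₗ[F] B[X] ⧸ coeffsIn (U (i + 1)) := fun i =>
    (coeffsIn (U (i + 1))).mkQ ∘ₗ LinearMap.mulLeft F (C e)
  have hφ : ∀ i v, φ i v = 0 ↔ C e * v ∈ coeffsIn (U (i + 1)) := fun i v => by
    simp [φ]
  have hqH := hPH hqP
  have hqT : ∀ i n, (T i n).map (LinearMap.mulLeft F q) ≤ T i (n + 1) := by
    rintro i n _ ⟨v, ⟨hv, hv'⟩, rfl⟩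
    refine ⟨?_, mul_mem_coeffsIn fun j k => hHU i _ (hqH j) _ (hv' k)⟩
    rw [pow_succ']
    exact Submodule.mul_mem_mul hqP hv
  let f : ℕ → ℕ → ℕ := fun i n => Module.finrank F ((T i n).map (φ i))
  -- If `e q v` lies in layer `i + 1`, so does `e v`; hence multiplication by `q` does not decrease
  -- the dimension of the image under `φ i`.
  have hf_le : ∀ i n, f i n ≤ Module.finrank F (((T i n).map (LinearMap.mulLeft F q)).map (φ i)) := by
    intro i n
    rw [← Submodule.map_comp]
    refine finrank_map_le_finrank_map (T i n) _ _ ?_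
    intro v hv h0
    rw [hφ]
    exact idempotent_mul_mem_coeffsIn he heH hHH (hHU (i + 1)) (hcomp i) hqH hq0 hv.2
      ((hφ i _).1 h0)
  have hf_mono : ∀ i n, f i n ≤ f i (n + 1) := fun i n =>
    (hf_le i n).trans (Submodule.finrank_mono (Submodule.map_mono (hqT i n)))
  have hf_lin : ∀ i n, f i n ≤ (K * n + 1) * Module.finrank F B := fun i n =>
    (Submodule.finrank_map_le _ _).trans <|
      (Submodule.finrank_mono (inf_le_left.trans (pow_le_polysLT hPK n))).trans
        (finrank_polysLT_le _)
  -- The slope of the linear bound for the sum of all `s` sequences `f i`.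
  let a := s * (K * Module.finrank F B)
  let b₀ := a * s
  -- Each descent adds an error of dimension at most `b₀` and then multiplies the whole error space
  -- by `P`.
  let b : ℕ → ℕ := fun i => Nat.rec 0 (fun _ r => Module.finrank F P * (r + b₀)) i
  refine ⟨b s, fun c => ?_⟩
  obtain ⟨n, hcn, hn⟩ := exists_bounded_window (fun n => ∑ i ∈ Finset.range s, f i n) s a
    (s * Module.finrank F B)
    (fun n => by
      refine (Finset.sum_le_card_nsmul _ _ _ fun i _ => hf_lin i n).trans ?_
      rw [Finset.card_range, smul_eq_mul]
      exact le_of_eq (by simp only [a]; ring)) c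
  have hmono' : ∀ i, Monotone (f i) := fun i => monotone_nat_of_le_succ (hf_mono i)
  -- All `f i` are monotone, so a bound on the growth of their sum over one window bounds every
  -- single increment inside it. Layer `i` uses the step from `n + i`, hence windows of length `s`.
  have hstep : ∀ i < s, f i (n + i + 1) ≤ f i (n + i) + b₀ := by
    intro i hi
    by_contra! hcon
    have hlt : ∑ j ∈ Finset.range s, f j n + b₀ < ∑ j ∈ Finset.range s, f j (n + s) := by
      rw [← Finset.add_sum_erase _ _ (Finset.mem_range.2 hi),
        ← Finset.add_sum_erase _ (fun j => f j (n + s)) (Finset.mem_range.2 hi)]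
      have h1 := hmono' i (show n ≤ n + i by omega)
      have h2 := hmono' i (show n + i + 1 ≤ n + s by omega)
      have h3 : ∑ j ∈ (Finset.range s).erase i, f j n ≤
          ∑ j ∈ (Finset.range s).erase i, f j (n + s) :=
        Finset.sum_le_sum fun j _ => hmono' j (by omega)
      omega
    exact absurd hn (by simpa [b₀] using hlt)
  -- The exponent starts at `n + 1` because `P ^ 0` contains `1`, which need not have its
  -- coefficient in `H = U 0`.
  have key : ∀ i ≤ s, ∃ D : Submodule F B[X], FiniteDimensional F D ∧
      Module.finrank F D ≤ b i ∧ P ^ (n + 1 + i) ≤ Q (n + 1 + i) ⊔ D ⊔ T i (n + 1 + i) := by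
    intro i
    induction i with
    | zero =>
      intro _
      refine ⟨⊥, inferInstance, by simp, le_sup_of_le_right (le_inf le_rfl ?_)⟩
      rw [hU0]
      exact hTH _ (by omega)
    | succ i ih =>
      intro hi
      obtain ⟨D, hDfin, hDb, hD⟩ := ih (by omega)
      obtain ⟨E, hEfin, hEb, hE⟩ := exists_le_sup_sup_ker _ _ (hqT i (n + i)) (φ i) b₀
        ((hstep i (by omega)).trans (Nat.add_le_add_right (hf_le i _) _))
      have hqQ' : (T i (n + i)).map (LinearMap.mulLeft F q) ≤ Q (n + i + 1) := by
        rintro _ ⟨v, hv, rfl⟩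
        exact hqQ _ v hv.1
      have hker : P * (T i (n + i + 1) ⊓ LinearMap.ker (φ i)) ≤ T (i + 1) (n + i + 1 + 1) := by
        rw [Submodule.mul_le]
        rintro u hu v ⟨⟨hv, hv'⟩, hv0⟩
        refine ⟨?_, mul_mem_coeffsIn fun j k => ?_⟩
        · rw [pow_succ']
          exact Submodule.mul_mem_mul hu hv
        · refine mul_mem_coeffsIn_of_idempotent_mul_mem (hHU (i + 1)) (hcomp i) (hPH hu j) (hv' k) ?_
          rw [← coeff_C_mul]
          exact (hφ i v).1 hv0 k
      have e1 : n + 1 + i = n + i + 1 := by omega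
      have e2 : n + 1 + (i + 1) = n + i + 1 + 1 := by omega
      rw [e1] at hD
      rw [e2]
      refine ⟨P * (D ⊔ E), ?_, ?_, ?_⟩
      · exact Module.Finite.iff_fg.2 ((Module.Finite.iff_fg.1 inferInstance).mul
          (Module.Finite.iff_fg.1 inferInstance))
      · refine (finrank_mul_le _ _).trans (Nat.mul_le_mul_left _ ?_)
        exact (Submodule.finrank_add_le_finrank_add_finrank D E).trans (add_le_add hDb hEb)
      · rw [pow_succ']
        refine (mul_le_mul' le_rfl (hD.trans (sup_le_sup le_rfl hE))).trans ?_
        simp only [Submodule.mul_sup]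
        refine sup_le (sup_le ?_ ?_) (sup_le (sup_le ?_ ?_) ?_)
        · exact (hPQ _).trans (le_sup_of_le_left le_sup_left)
        · exact le_sup_of_le_left (le_sup_of_le_right le_sup_left)
        · exact (mul_le_mul' le_rfl hqQ').trans ((hPQ _).trans (le_sup_of_le_left le_sup_left))
        · exact le_sup_of_le_left (le_sup_of_le_right le_sup_right)
        · exact le_sup_of_le_right hker
  obtain ⟨D, hDfin, hDb, hD⟩ := key s le_rfl
  refine ⟨n + 1 + s, by omega, D, hDfin, hDb, hD.trans ?_⟩
  refine sup_le le_rfl (inf_le_right.trans ?_)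
  rw [hUs, coeffsIn_bot]
  exact bot_le

end PolynomialFiltration

end DiffPoly

namespace DiffPoly

open Polynomial
open scoped Classical

/-! ### Words as a basis of the free algebra. -/

section Words

variable {F : Type*} [Field F]

/-- The monomial of a word. -/
def word (F : Type*) [Field F] (l : List Gen) : FreeAlg F := (l.map (FreeAlgebra.ι F)).prod

theorem word_nil : word F [] = 1 := rfl

theorem word_cons (g : Gen) (l : List Gen) : word F (g :: l) = FreeAlgebra.ι F g * word F l := by
  simp [word]

theorem word_append (l l' : List Gen) : word F (l ++ l') = word F l * word F l' := by
  simp [word]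

/-- The basis of the free algebra given by the words. -/
noncomputable def wordBasis (F : Type*) [Field F] : Module.Basis (List Gen) F (FreeAlg F) :=
  (FreeAlgebra.basisFreeMonoid F Gen).reindex FreeMonoid.toList

theorem wordBasis_apply (l : List Gen) : wordBasis F l = word F l := by
  simp only [wordBasis, Module.Basis.reindex_apply, FreeAlgebra.basisFreeMonoid,
    Module.Basis.map_apply, Finsupp.coe_basisSingleOne]
  change FreeAlgebra.equivMonoidAlgebraFreeMonoid.symm
    (MonoidAlgebra.single (FreeMonoid.ofList l) (1 : F)) = _
  rw [AlgEquiv.symm_apply_eq, word, map_list_prod, List.map_map]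
  induction l with
  | nil => rfl
  | cons g l ih =>
    rw [List.map_cons, List.prod_cons, ← ih, FreeMonoid.ofList_cons]
    simp [FreeAlgebra.equivMonoidAlgebraFreeMonoid]

/-- The coefficient of a word. -/
noncomputable def wordCoeff (w : List Gen) : FreeAlg F →ₗ[F] F := (wordBasis F).coord w

theorem wordCoeff_word (w l : List Gen) : wordCoeff w (word F l) = if l = w then 1 else 0 := by
  rw [wordCoeff, ← wordBasis_apply, Module.Basis.coord_apply, Module.Basis.repr_self,
    Finsupp.single_apply]

theorem eq_zero_of_wordCoeff {z : FreeAlg F} (h : ∀ w, wordCoeff w z = 0) : z = 0 :=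
  (wordBasis F).forall_coord_eq_zero_iff.1 h

/-- The span of a set of words. -/
def wordSpan (F : Type*) [Field F] (S : Set (List Gen)) : Submodule F (FreeAlg F) :=
  Submodule.span F (word F '' S)

theorem word_mem_wordSpan {S : Set (List Gen)} {l : List Gen} (h : l ∈ S) :
    word F l ∈ wordSpan F S := Submodule.subset_span ⟨l, h, rfl⟩

theorem mem_wordSpan {S : Set (List Gen)} {z : FreeAlg F} :
    z ∈ wordSpan F S ↔ ∀ w, w ∉ S → wordCoeff w z = 0 := by
  have e : (word F : List Gen → FreeAlg F) = wordBasis F := funext fun l => (wordBasis_apply l).symm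
  rw [wordSpan, e, Module.Basis.mem_span_image]
  refine ⟨fun h w hw => by_contra fun h0 => hw (h ?_), fun h w hw => by_contra fun h0 => ?_⟩
  · simpa [wordCoeff] using h0
  · exact (by simpa using hw : (wordBasis F).repr z w ≠ 0) (h w h0)

theorem wordSpan_univ : wordSpan F Set.univ = ⊤ := by
  rw [eq_top_iff]
  exact fun z _ => mem_wordSpan.2 fun w hw => absurd trivial hw

theorem mul_mem_wordSpan {S S' T : Set (List Gen)} (h : ∀ l ∈ S, ∀ l' ∈ S', l ++ l' ∈ T)
    {y z : FreeAlg F} (hy : y ∈ wordSpan F S) (hz : z ∈ wordSpan F S') : y * z ∈ wordSpan F T := by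
  have hle : wordSpan F S * wordSpan F S' ≤ wordSpan F T := by
    rw [wordSpan, wordSpan, Submodule.span_mul_span, Submodule.span_le]
    rintro _ ⟨_, ⟨l, hl, rfl⟩, _, ⟨l', hl', rfl⟩, rfl⟩
    change word F l * word F l' ∈ _
    rw [← word_append]
    exact word_mem_wordSpan (h l hl l' hl')
  exact hle (Submodule.mul_mem_mul hy hz)

/-- Only one pair of words can contribute to the coefficient, since the factorization of `u ++ v` is
unique within `S` and `S'`. -/
theorem wordCoeff_append_mul {S S' : Set (List Gen)} {u v : List Gen}
    (h : ∀ l ∈ S, ∀ l' ∈ S', l ++ l' = u ++ v → l = u ∧ l' = v)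
    {y z : FreeAlg F} (hy : y ∈ wordSpan F S) (hz : z ∈ wordSpan F S') :
    wordCoeff (u ++ v) (y * z) = wordCoeff u y * wordCoeff v z := by
  induction hy using Submodule.span_induction with
  | zero => simp
  | add y y' _ _ h1 h2 => rw [add_mul, map_add, h1, h2, map_add, add_mul]
  | smul r y _ h1 => rw [smul_mul_assoc, map_smul, h1, map_smul, smul_mul_assoc]
  | mem y hy =>
    obtain ⟨l, hl, rfl⟩ := hy
    induction hz using Submodule.span_induction with
    | zero => simp
    | add y y' _ _ h1 h2 => rw [mul_add, map_add, h1, h2, map_add, mul_add]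
    | smul r y _ h1 => rw [mul_smul_comm, map_smul, h1, map_smul, mul_smul_comm]
    | mem y hy =>
      obtain ⟨l', hl', rfl⟩ := hy
      rw [← word_append, wordCoeff_word, wordCoeff_word, wordCoeff_word]
      by_cases h1 : l = u ∧ l' = v
      · rw [if_pos h1.1, if_pos h1.2, if_pos (by rw [h1.1, h1.2]), mul_one]
      · rw [if_neg fun h0 => h1 (h l hl l' hl' h0), ite_zero_mul_ite_zero, if_neg h1]

end Words

/-! ### Unique factorization of words into blocks. -/

section Blocks

/-- The degree of a word. -/
def wordDeg (l : List Gen) : ℕ := (l.map Gen.deg).sum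

theorem wordDeg_append (l l' : List Gen) : wordDeg (l ++ l') = wordDeg l + wordDeg l' := by
  simp [wordDeg]

/-- The words that begin with `a` or `b`. -/
def startWords : Set (List Gen) := {l | ∃ g l', g ≠ Gen.x ∧ l = g :: l'}

/-- The words of degree `α` that begin with `a` or `b`. -/
def blocks (α : ℕ) : Set (List Gen) := {l | l ∈ startWords ∧ wordDeg l = α}

/-- The concatenations of `n` words of degree `α` that begin with `a` or `b`. -/
def blockPow (α : ℕ) : ℕ → Set (List Gen)
  | 0 => {[]}
  | n + 1 => Set.image2 (· ++ ·) (blocks α) (blockPow α n)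

theorem eq_nil_or_mem_startWords {α n : ℕ} {l : List Gen} (h : l ∈ blockPow α n) :
    l = [] ∨ l ∈ startWords := by
  cases n with
  | zero => exact Or.inl h
  | succ n =>
    obtain ⟨_, ⟨⟨g, u, hg, rfl⟩, -⟩, v, -, rfl⟩ := h
    exact Or.inr ⟨g, u ++ v, hg, rfl⟩

theorem deg_ne_zero {g : Gen} (h : g ≠ Gen.x) : g.deg ≠ 0 := by
  cases g <;> simp_all [Gen.deg]

/-- If the prefixes had different lengths, their difference would have degree zero, hence consist of
letters `x` only; but it begins one of the tails, which cannot start with `x`. -/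
theorem append_inj_of_wordDeg {u u' v v' : List Gen} (hd : wordDeg u = wordDeg u')
    (hv : v = [] ∨ v ∈ startWords) (hv' : v' = [] ∨ v' ∈ startWords) (h : u ++ v = u' ++ v') :
    u = u' ∧ v = v' := by
  have key : ∀ (r t : List Gen), wordDeg r = 0 → (r ++ t = [] ∨ r ++ t ∈ startWords) →
      r = [] := by
    rintro (_ | ⟨g, r⟩) t hr ht
    · rfl
    · exfalso
      rcases ht with ht | ⟨g', l', hg', ht⟩
      · simp at ht
      · rw [List.cons_append, List.cons.injEq] at ht
        refine deg_ne_zero hg' ?_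
        rw [← ht.1]
        simp [wordDeg] at hr
        exact hr.1
  rcases List.append_eq_append_iff.1 h with ⟨r, rfl, rfl⟩ | ⟨r, rfl, rfl⟩
  · rw [wordDeg_append] at hd
    obtain rfl := key r v' (by omega) hv
    simp
  · rw [wordDeg_append] at hd
    obtain rfl := key r v (by omega) hv'
    simp

end Blocks

/-! ### The maps `γ_t`, and words with and without `x`. -/

section FreeAlgebraFacts

variable {F : Type*} [Field F]

theorem gamma_ι (t : F) (g : Gen) : gamma t (FreeAlgebra.ι F g) =
    match g with
    | Gen.a => genA F
    | Gen.b => genB F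
    | Gen.x => genX F + algebraMap F (FreeAlg F) t := FreeAlgebra.lift_ι_apply _ _

theorem gamma_ι_of_ne (t : F) {g : Gen} (h : g ≠ Gen.x) :
    gamma t (FreeAlgebra.ι F g) = FreeAlgebra.ι F g := by
  rw [gamma_ι]
  cases g <;> first | rfl | exact absurd rfl h

theorem gamma_zero : gamma (0 : F) = AlgHom.id F (FreeAlg F) := by
  refine FreeAlgebra.hom_ext (funext fun g => ?_)
  rw [Function.comp_apply, gamma_ι]
  cases g <;> simp [genA, genB, genX]

theorem gamma_word_mem (t : F) (l : List Gen) :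
    gamma t (word F l) ∈ wordSpan F {w | wordDeg w = wordDeg l} := by
  induction l with
  | nil =>
    rw [word_nil, map_one, ← word_nil]
    exact word_mem_wordSpan rfl
  | cons g l ih =>
    rw [word_cons, map_mul]
    refine mul_mem_wordSpan (S := {w | wordDeg w = wordDeg [g]}) ?_ ?_ ih
    · intro u hu v hv
      change wordDeg _ = wordDeg ([g] ++ l)
      rw [wordDeg_append, wordDeg_append]
      exact congrArg₂ _ hu hv
    · have hι : FreeAlgebra.ι F g = word F [g] := by simp [word]
      by_cases hg : g = Gen.x
      · subst hg
        rw [gamma_ι]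
        change genX F + algebraMap F (FreeAlg F) t ∈ wordSpan F _
        rw [genX, hι, Algebra.algebraMap_eq_smul_one, ← word_nil]
        exact Submodule.add_mem _ (word_mem_wordSpan rfl)
          (Submodule.smul_mem _ _ (word_mem_wordSpan rfl))
      · rw [gamma_ι_of_ne t hg, hι]
        exact word_mem_wordSpan rfl

/-- `γ_t` fixes the leading `a` or `b` and preserves the degree of the rest. -/
theorem gamma_mem_wordSpan_blocks (t : F) {α : ℕ} {z : FreeAlg F} (hz : z ∈ wordSpan F (blocks α)) :
    gamma t z ∈ wordSpan F (blocks α) := by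
  suffices h : wordSpan F (blocks α) ≤ (wordSpan F (blocks α)).comap (gamma t).toLinearMap from h hz
  refine Submodule.span_le.2 ?_
  rintro _ ⟨_, ⟨⟨g, l, hg, rfl⟩, hd⟩, rfl⟩
  change gamma t (word F (g :: l)) ∈ wordSpan F (blocks α)
  rw [word_cons, map_mul, gamma_ι_of_ne t hg]
  have hι : FreeAlgebra.ι F g = word F [g] := by simp [word]
  rw [hι]
  refine mul_mem_wordSpan (S := {[g]}) ?_ (word_mem_wordSpan rfl) (gamma_word_mem t l)
  rintro _ rfl v hv
  refine ⟨⟨g, v, hg, rfl⟩, ?_⟩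
  rw [wordDeg_append, ← hd, show g :: l = [g] ++ l from rfl, wordDeg_append]
  exact congrArg _ hv

theorem algA_le_wordSpan {z : FreeAlg F} (hz : z ∈ algA F) : z ∈ wordSpan F startWords := by
  have hgen : ∀ (g : Gen) (i : ℕ), g ≠ Gen.x →
      FreeAlgebra.ι F g * genX F ^ i ∈ wordSpan F startWords := by
    intro g i hg
    have : FreeAlgebra.ι F g * genX F ^ i = word F (g :: List.replicate i Gen.x) := by
      simp [word, genX]
    rw [this]
    exact word_mem_wordSpan ⟨g, _, hg, rfl⟩
  induction hz using NonUnitalAlgebra.adjoin_induction with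
  | mem z hz =>
    obtain ⟨i, rfl | rfl⟩ := hz
    · exact hgen _ i (by simp)
    · exact hgen _ i (by simp)
  | add y z _ _ hy hz => exact Submodule.add_mem _ hy hz
  | zero => exact Submodule.zero_mem _
  | smul r z _ hz => exact Submodule.smul_mem _ r hz
  | mul y z _ _ hy hz =>
    refine mul_mem_wordSpan ?_ hy hz
    rintro _ ⟨g, l, hg, rfl⟩ l' _
    exact ⟨g, l ++ l', hg, rfl⟩

theorem algAPart_le_wordSpan {α : ℕ} {z : FreeAlg F} (hz : z ∈ algAPart F α) :
    z ∈ wordSpan F (blocks α) := by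
  have h2 : z ∈ wordSpan F {l | wordDeg l = α} := by
    have hle : degreePart F α ≤ wordSpan F {l | wordDeg l = α} := by
      refine Submodule.span_le.2 ?_
      rintro _ ⟨l, hl, rfl⟩
      exact word_mem_wordSpan hl
    exact hle hz.2
  rw [mem_wordSpan] at h2 ⊢
  intro w hw
  by_cases h : w ∈ startWords
  · exact h2 w fun hd => hw ⟨h, hd⟩
  · exact mem_wordSpan.1 (algA_le_wordSpan hz.1) w h

/-- The homomorphism that sends `x` to `0`. -/
def killX (F : Type*) [Field F] : FreeAlg F →ₐ[F] FreeAlg F :=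
  FreeAlgebra.lift F fun g : Gen =>
    match g with
    | Gen.a => genA F
    | Gen.b => genB F
    | Gen.x => 0

theorem killX_word (l : List Gen) :
    killX F (word F l) = if Gen.x ∈ l then 0 else word F l := by
  induction l with
  | nil => simp [word_nil]
  | cons g l ih =>
    rw [word_cons, map_mul, ih, killX, FreeAlgebra.lift_ι_apply]
    cases g <;> by_cases h : Gen.x ∈ l <;> simp [h, genA, genB]

/-- Since `killX` projects onto the words without `x`, vanishes on `⟨x⟩` and fixes `R`, this
describes the coefficients of elements of both. -/
theorem wordCoeff_killX (w : List Gen) (z : FreeAlg F) :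
    wordCoeff w (killX F z) = if Gen.x ∈ w then 0 else wordCoeff w z := by
  have hz : z ∈ wordSpan F Set.univ := by rw [wordSpan_univ]; trivial
  induction hz using Submodule.span_induction with
  | zero => simp
  | add y y' _ _ h1 h2 => rw [map_add, map_add, h1, h2, map_add]; split_ifs <;> simp
  | smul r y _ h1 => rw [map_smul, map_smul, h1, map_smul]; split_ifs <;> simp
  | mem y hy =>
    obtain ⟨l, -, rfl⟩ := hy
    rw [killX_word]
    by_cases hl : Gen.x ∈ l
    · rw [if_pos hl, map_zero, wordCoeff_word]
      split_ifs with h1 h2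
      · rfl
      · exact absurd (h2 ▸ hl) h1
      · rfl
    · rw [if_neg hl, wordCoeff_word]
      split_ifs with h1 h2
      · exact absurd h2 (h1 ▸ hl)
      · rfl
      · rfl
      · rfl

theorem wordCoeff_eq_zero_of_mem_idealX {z : FreeAlg F} (hz : z ∈ idealX F) {w : List Gen}
    (hw : Gen.x ∉ w) : wordCoeff w z = 0 := by
  have hle : idealX F ≤ TwoSidedIdeal.ker (killX F) := by
    rw [idealX, TwoSidedIdeal.span_le]
    rintro _ rfl
    rw [SetLike.mem_coe, TwoSidedIdeal.mem_ker, genX, killX, FreeAlgebra.lift_ι_apply]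
  have h0 : killX F z = 0 := (TwoSidedIdeal.mem_ker _).1 (hle hz)
  have := wordCoeff_killX w z
  rwa [h0, map_zero, if_neg hw, eq_comm] at this

theorem wordCoeff_eq_zero_of_mem_algR {z : FreeAlg F} (hz : z ∈ algR F) {w : List Gen}
    (hw : Gen.x ∈ w) : wordCoeff w z = 0 := by
  have h0 : killX F z = z := by
    induction hz using NonUnitalAlgebra.adjoin_induction with
    | mem z hz =>
      rcases hz with rfl | rfl
      · rw [genA, killX, FreeAlgebra.lift_ι_apply]; rfl
      · rw [genB, killX, FreeAlgebra.lift_ι_apply]; rfl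
    | add y z _ _ hy hz => rw [map_add, hy, hz]
    | zero => exact map_zero _
    | smul r z _ hz => rw [map_smul, hz]
    | mul y z _ _ hy hz => rw [map_mul, hy, hz]
  have := wordCoeff_killX w z
  rwa [h0, if_pos hw] at this

theorem eval_algebraMap_mul {B : Type*} [Ring B] [Algebra F B] (t : F) (p r : B[X]) :
    (p * r).eval (algebraMap F B t) = p.eval (algebraMap F B t) * r.eval (algebraMap F B t) :=
  eval₂_mul_noncomm _ _ fun _ => (Algebra.commutes t _).symm

/-- The scalar `t` is central, so evaluation at it is multiplicative despite the noncommuting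
coefficients, and it suffices to treat the generators. -/
theorem exists_polynomial_gamma (z : FreeAlg F) :
    ∃ p : (FreeAlg F)[X], ∀ t : F, gamma t z = p.eval (algebraMap F (FreeAlg F) t) := by
  induction z using FreeAlgebra.induction with
  | grade0 r => exact ⟨C (algebraMap F _ r), fun t => by rw [AlgHom.commutes, eval_C]⟩
  | grade1 g =>
    by_cases hg : g = Gen.x
    · subst hg
      exact ⟨C (genX F) + X, fun t => by rw [gamma_ι, eval_add, eval_C, eval_X]⟩
    · exact ⟨C (FreeAlgebra.ι F g), fun t => by rw [gamma_ι_of_ne t hg, eval_C]⟩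
  | mul y z hy hz =>
    obtain ⟨p, hp⟩ := hy
    obtain ⟨r, hr⟩ := hz
    refine ⟨p * r, fun t => ?_⟩
    rw [map_mul, hp, hr, eval_algebraMap_mul]
  | add y z hy hz =>
    obtain ⟨p, hp⟩ := hy
    obtain ⟨r, hr⟩ := hz
    exact ⟨p + r, fun t => by rw [map_add, hp, hr, eval_add]⟩

end FreeAlgebraFacts

end DiffPoly

namespace DiffPoly

open Polynomial
open scoped Classical

/-! ### Word coefficients of matrix powers. -/

section MatrixCoefficients

variable {F : Type*} [Field F] {d : ℕ}

/-- The coefficient of a word in a matrix, taken entrywise. -/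
noncomputable def matCoeff (w : List Gen) (N : Matrix (Fin d) (Fin d) (FreeAlg F)) :
    Matrix (Fin d) (Fin d) F := N.map (wordCoeff w)

theorem pow_entry_mem_wordSpan {α : ℕ} {N : Matrix (Fin d) (Fin d) (FreeAlg F)}
    (hN : ∀ i j, N i j ∈ wordSpan F (blocks α)) (n : ℕ) (i j : Fin d) :
    (N ^ n) i j ∈ wordSpan F (blockPow α n) := by
  induction n generalizing i j with
  | zero =>
    rw [pow_zero, Matrix.one_apply]
    split_ifs
    · exact word_mem_wordSpan (F := F) (l := []) rfl
    · exact Submodule.zero_mem _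
  | succ n ih =>
    rw [pow_succ', Matrix.mul_apply]
    exact Submodule.sum_mem _ fun k _ =>
      mul_mem_wordSpan (fun u hu v hv => Set.mem_image2_of_mem hu hv) (hN i k) (ih k j)

theorem matCoeff_append_pow {α : ℕ} {N : Matrix (Fin d) (Fin d) (FreeAlg F)}
    (hN : ∀ i j, N i j ∈ wordSpan F (blocks α)) {n : ℕ} {u v : List Gen}
    (hu : u ∈ blocks α) (hv : v ∈ blockPow α n) :
    matCoeff (u ++ v) (N ^ (n + 1)) = matCoeff u N * matCoeff v (N ^ n) := by
  ext i j
  simp only [matCoeff, Matrix.map_apply, pow_succ', Matrix.mul_apply, map_sum]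
  refine Finset.sum_congr rfl fun k _ => ?_
  refine wordCoeff_append_mul ?_ (hN i k) (pow_entry_mem_wordSpan hN n k j)
  intro l hl l' hl' h
  exact append_inj_of_wordDeg (hl.2.trans hu.2.symm) (eq_nil_or_mem_startWords hl')
    (eq_nil_or_mem_startWords hv) h

/-- The polynomial `p` interpolates the coefficients of `w` in the matrices `N t`. -/
def Interpolates (p : (Matrix (Fin d) (Fin d) F)[X]) (w : List Gen)
    (N : F → Matrix (Fin d) (Fin d) (FreeAlg F)) : Prop :=
  ∀ t, p.eval (algebraMap F _ t) = matCoeff w (N t)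

theorem Interpolates.mul_pow {α n : ℕ} {p r : (Matrix (Fin d) (Fin d) F)[X]} {u v : List Gen}
    {N : F → Matrix (Fin d) (Fin d) (FreeAlg F)}
    (hN : ∀ t i j, N t i j ∈ wordSpan F (blocks α)) (hu : u ∈ blocks α) (hv : v ∈ blockPow α n)
    (hp : Interpolates p u N) (hr : Interpolates r v fun t => N t ^ n) :
    Interpolates (p * r) (u ++ v) fun t => N t ^ (n + 1) := fun t => by
  rw [matCoeff_append_pow (hN t) hu hv, ← hp t, ← hr t, eval_algebraMap_mul]

end MatrixCoefficients

/-! ### From spaces of coefficient polynomials to the dimension of `R ∩ S(L(M ^ m))`. -/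

section Duality

variable {F : Type*} [Field F] {d : ℕ}

theorem spaceS_spaceL_le (N : Matrix (Fin d) (Fin d) (FreeAlg F)) :
    spaceS (spaceL N) ≤ Submodule.span F
      (Set.range fun x : F × Fin d × Fin d => gamma x.1 (N x.2.1 x.2.2)) := by
  refine Submodule.span_le.2 ?_
  rintro _ ⟨N', hN', i, j, rfl⟩
  induction hN' using Submodule.span_induction with
  | mem N' h =>
    obtain ⟨t, rfl⟩ := h
    exact Submodule.subset_span ⟨(t, i, j), rfl⟩
  | zero => exact Submodule.zero_mem _
  | add N' N'' _ _ h h' => exact Submodule.add_mem _ h h'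
  | smul r N' _ h => exact Submodule.smul_mem _ r h

/-- Evaluation of polynomials at scalars, combined with the reading of matrix entries. -/
noncomputable def evalEntries (F : Type*) [Field F] (d : ℕ) : (F × Fin d × Fin d →₀ F) →ₗ[F]
    (Matrix (Fin d) (Fin d) F)[X] →ₗ[F] F :=
  Finsupp.linearCombination F fun x =>
    { toFun := fun p => p.eval (algebraMap F _ x.1) x.2.1 x.2.2
      map_add' := fun p q => by rw [eval_add, Matrix.add_apply]
      map_smul' := fun c p => by
        change (c • p).eval (algebraMap F (Matrix (Fin d) (Fin d) F) x.1) x.2.1 x.2.2 =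
          (c • p.eval (algebraMap F (Matrix (Fin d) (Fin d) F) x.1)) x.2.1 x.2.2
        rw [← smul_one_smul (Matrix (Fin d) (Fin d) F) c p, eval_smul, smul_one_smul] }

/-- If `p` interpolates the coefficients of `w`, then the functionals on polynomials compute
these coefficients. -/
theorem evalEntries_apply {N : F → Matrix (Fin d) (Fin d) (FreeAlg F)}
    {p : (Matrix (Fin d) (Fin d) F)[X]} {w : List Gen} (hp : Interpolates p w N)
    (c : F × Fin d × Fin d →₀ F) :
    evalEntries F d c p =
      wordCoeff w (Finsupp.linearCombination F (fun x => N x.1 x.2.1 x.2.2) c) := by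
  rw [evalEntries, Finsupp.linearCombination_apply, Finsupp.linearCombination_apply, Finsupp.sum,
    Finsupp.sum, LinearMap.sum_apply, map_sum]
  refine Finset.sum_congr rfl fun x _ => ?_
  rw [LinearMap.smul_apply, map_smul]
  change _ • p.eval (algebraMap F _ x.1) x.2.1 x.2.2 = _
  rw [hp]
  rfl

theorem exists_eq_span_range {B : Type*} [Ring B] [Algebra F B] (D : Submodule F B[X])
    [FiniteDimensional F D] :
    ∃ β : Fin (Module.finrank F D) → B[X], D = Submodule.span F (Set.range β) := by
  refine ⟨fun i => Module.finBasis F D i, ?_⟩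
  have h := congrArg (Submodule.map D.subtype) (Module.finBasis F D).span_eq
  rw [Submodule.map_span, ← Set.range_comp, Submodule.map_top, Submodule.range_subtype] at h
  exact h.symm

/-- Lift `z` in the intersection to a formal combination `c` of evaluated entries; pairing `c` with
an interpolating polynomial gives a word coefficient of `z`. Words with `x` give zero because `z ∈
R`. If `c` also kills `D`, it kills `T`, so all coefficients of `z` vanish. Pairing with a basis of
`D` is thus injective. -/
theorem finrank_algR_inf_le {m α : ℕ} {M : Matrix (Fin d) (Fin d) (FreeAlg F)}
    (hM : ∀ t i j, (M.map (gamma t)) i j ∈ wordSpan F (blocks α))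
    {T D : Submodule F (Matrix (Fin d) (Fin d) F)[X]} [FiniteDimensional F D]
    (hT : ∀ w ∈ blockPow α m, ∃ p ∈ T, Interpolates p w fun t => M.map (gamma t) ^ m)
    (hTD : T ≤ Submodule.span F {p | ∃ w, Gen.x ∈ w ∧
      Interpolates p w fun t => M.map (gamma t) ^ m} ⊔ D) :
    FiniteDimensional F ↥((algR F).toSubmodule ⊓ spaceS (spaceL (M ^ m))) ∧
      Module.finrank F ↥((algR F).toSubmodule ⊓ spaceS (spaceL (M ^ m))) ≤ Module.finrank F D := by
  set V := (algR F).toSubmodule ⊓ spaceS (spaceL (M ^ m))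
  set Ψ : (F × Fin d × Fin d →₀ F) →ₗ[F] FreeAlg F :=
    Finsupp.linearCombination F fun x => (M.map (gamma x.1) ^ m) x.2.1 x.2.2 with hΨ
  have hpow : ∀ t i j, gamma t ((M ^ m) i j) = (M.map (gamma t) ^ m) i j := fun t i j => by
    rw [← AlgHom.mapMatrix_apply, ← map_pow]
    rfl
  have hV : V ≤ LinearMap.range Ψ := by
    refine inf_le_right.trans ((spaceS_spaceL_le _).trans ?_)
    rw [hΨ, Finsupp.range_linearCombination]
    refine le_of_eq ?_
    simp only [hpow]
  obtain ⟨σ, hσ⟩ := LinearMap.exists_rightInverse_of_surjective Ψ.rangeRestrict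
    Ψ.range_rangeRestrict
  have hσ' : ∀ z : V, Ψ (σ ⟨z, hV z.2⟩) = z := fun z =>
    congrArg Subtype.val (LinearMap.congr_fun hσ ⟨z, hV z.2⟩)
  obtain ⟨β, hβ⟩ := exists_eq_span_range D
  let Θ : V →ₗ[F] Fin (Module.finrank F D) → F := LinearMap.pi fun i =>
    (evalEntries F d).flip (β i) ∘ₗ σ ∘ₗ Submodule.inclusion hV
  have hΘ : Function.Injective Θ := by
    rw [← LinearMap.ker_eq_bot, eq_bot_iff]
    rintro z hz
    set c := σ ⟨z, hV z.2⟩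
    have hD : D ≤ LinearMap.ker (evalEntries F d c) := by
      rw [hβ, Submodule.span_le]
      rintro _ ⟨i, rfl⟩
      exact congrFun (show Θ z = 0 from hz) i
    have hQ : Submodule.span F {p | ∃ w, Gen.x ∈ w ∧
        Interpolates p w fun t => M.map (gamma t) ^ m} ≤ LinearMap.ker (evalEntries F d c) := by
      rw [Submodule.span_le]
      rintro p ⟨w, hw, hp⟩
      change evalEntries F d c p = 0
      rw [evalEntries_apply hp, ← hΨ, hσ']
      exact wordCoeff_eq_zero_of_mem_algR z.2.1 hw
    have hker := hTD.trans (sup_le hQ hD)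
    have hrange : ∀ c, Ψ c ∈ wordSpan F (blockPow α m) := fun c => by
      rw [hΨ, Finsupp.linearCombination_apply]
      exact Submodule.sum_mem _ fun x _ => Submodule.smul_mem _ _
        (pow_entry_mem_wordSpan (hM x.1) m _ _)
    have hsupp : (z : FreeAlg F) ∈ wordSpan F (blockPow α m) := hσ' z ▸ hrange _
    rw [Submodule.mem_bot, Subtype.ext_iff]
    refine eq_zero_of_wordCoeff fun w => ?_
    by_cases hw : w ∈ blockPow α m
    · obtain ⟨p, hpT, hp⟩ := hT w hw
      have h0 : evalEntries F d c p = 0 := hker hpT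
      rwa [evalEntries_apply hp, ← hΨ, hσ'] at h0
    · exact mem_wordSpan.1 hsupp w hw
  exact ⟨FiniteDimensional.of_injective Θ hΘ,
    (LinearMap.finrank_le_finrank_of_injective hΘ).trans_eq (Module.finrank_fin_fun F)⟩

end Duality

/-! ### The polynomials attached to an idempotent presentation. -/

section IdempotentPresentation

variable {F : Type*} [Field F]

/-- Linearly independent elements are separated by a combination of word coefficients. -/
theorem span_wordCoeff_eq_top {ι : Type*} [Fintype ι] {a : ι → FreeAlg F}
    (ha : LinearIndependent F a) (S : Set (List Gen)) (haS : ∀ i, a i ∈ wordSpan F S) :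
    Submodule.span F ((fun w i => wordCoeff w (a i)) '' S) = (⊤ : Submodule F (ι → F)) := by
  by_contra hne
  obtain ⟨f, hf0, hf⟩ := Submodule.exists_le_ker_of_lt_top _ (lt_top_iff_ne_top.2 hne)
  refine hf0 (LinearMap.pi_ext' fun i => LinearMap.ext_ring ?_)
  have hsum : ∀ v : ι → F, f v = ∑ i, f (Pi.single i 1) * v i := fun v => by
    conv_lhs => rw [← Finset.univ_sum_single v]
    rw [map_sum]
    refine Finset.sum_congr rfl fun i _ => ?_
    rw [← mul_one (v i), ← smul_eq_mul (v i), Pi.single_smul, map_smul, smul_eq_mul, smul_eq_mul,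
      mul_one, mul_comm]
  -- A functional vanishing on all coefficient vectors is a linear relation among the `a i`.
  have hz : ∑ i, f (Pi.single i 1) • a i = 0 := by
    refine eq_zero_of_wordCoeff fun w => ?_
    by_cases hw : w ∈ S
    · have h0 : f (fun i => wordCoeff w (a i)) = 0 := hf (Submodule.subset_span ⟨w, hw, rfl⟩)
      rw [hsum] at h0
      simpa [map_sum] using h0
    · exact mem_wordSpan.1 (Submodule.sum_mem _ fun i _ => Submodule.smul_mem _ _ (haS i)) w hw
  simpa using Fintype.linearIndependent_iff.1 ha _ hz i

/-- The layers are `W ^ i * H` rather than `W ^ i`, so that layer `0` is `H` and not the scalars. -/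
theorem pow_mul_radical_le {B : Type*} [Ring B] [Algebra F B] {H W : Submodule F B}
    (hHW : H * W ≤ W) (hHH : H * H ≤ H) (i : ℕ) : H * (W ^ i * H) ≤ W ^ i * H := by
  cases i with
  | zero => simpa using hHH
  | succ i =>
    rw [pow_succ', ← mul_assoc, ← mul_assoc]
    exact mul_le_mul' (mul_le_mul' hHW le_rfl) le_rfl

/-- A matrix with an idempotent presentation satisfies a uniform bound on infinitely many
powers. -/
theorem HasIdempotentPresentation.exists_finrank_le {d : ℕ}
    {M : Matrix (Fin d) (Fin d) (FreeAlg F)} (h : HasIdempotentPresentation M) :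
    ∃ b : ℕ, ∀ c : ℕ, ∃ m, c < m ∧
      FiniteDimensional F ↥((algR F).toSubmodule ⊓ spaceS (spaceL (M ^ m))) ∧
      Module.finrank F ↥((algR F).toSubmodule ⊓ spaceS (spaceL (M ^ m))) ≤ b := by
  obtain ⟨ξ, α, A, a, rfl, hlin, -, ha, he, hW⟩ := h
  set M := ∑ i, (A i).map (fun c : F => c • a i) with hM
  set H := NonUnitalAlgebra.adjoin F (Set.range A)
  have hrad : IsNilpotentIdeal H (wedderburnRadical H) := (isGreatest_wedderburnRadical H).1
  set W := wedderburnRadical H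
  obtain ⟨s, hs⟩ := hrad.nilpotent
  have hAH : ∀ i, A i ∈ H := fun i => NonUnitalAlgebra.subset_adjoin F ⟨i, rfl⟩
  have haB : ∀ i, a i ∈ wordSpan F (blocks α) := fun i => algAPart_le_wordSpan (ha i).1
  choose c hc using fun i => exists_polynomial_gamma (a i)
  have hc0 : ∀ i, (c i).coeff 0 = a i := fun i => by
    have := hc i 0
    rw [gamma_zero, map_zero, ← coeff_zero_eq_eval_zero] at this
    exact this.symm
  -- A common bound for the degrees in `t` of all `γ_t (a i)`, hence of all `p w`.
  let K := Finset.univ.sup fun i => (c i).natDegree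
  let p : List Gen → (Matrix (Fin d) (Fin d) F)[X] := fun w =>
    ∑ i, ∑ k ∈ Finset.range (K + 1), monomial k (wordCoeff w ((c i).coeff k) • A i)
  let N : F → Matrix (Fin d) (Fin d) (FreeAlg F) := fun t => M.map (gamma t)
  have hN : ∀ t i j, N t i j = ∑ l, A l i j • gamma t (a l) := fun t i j => by
    simp [N, hM, Matrix.sum_apply]
  have hNB : ∀ t i j, N t i j ∈ wordSpan F (blocks α) := fun t i j => by
    rw [hN]
    exact Submodule.sum_mem _ fun l _ => Submodule.smul_mem _ _
      (gamma_mem_wordSpan_blocks t (haB l))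
  have hcoeff : ∀ w k, (p w).coeff k =
      if k < K + 1 then ∑ i, wordCoeff w ((c i).coeff k) • A i else 0 := fun w k => by
    simp only [p, finsetSum_coeff, coeff_monomial, Finset.sum_ite_eq', Finset.mem_range]
    split_ifs <;> simp
  have hp : ∀ w, Interpolates (p w) w N := fun w t => by
    ext i j
    simp only [p, matCoeff, Matrix.map_apply, hN, map_sum, map_smul, eval_finsetSum, eval_monomial,
      Matrix.sum_apply]
    refine Finset.sum_congr rfl fun l _ => ?_
    rw [hc, eval_eq_sum_range' (n := K + 1)
      (Nat.lt_succ_of_le (Finset.le_sup (f := fun i => (c i).natDegree) (Finset.mem_univ l))),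
      map_sum, Finset.smul_sum]
    refine Finset.sum_congr rfl fun k _ => ?_
    rw [← map_pow, ← map_pow, ← Algebra.commutes, ← Algebra.commutes, ← Algebra.smul_def,
      ← Algebra.smul_def, map_smul, Matrix.smul_apply, Matrix.smul_apply]
    simp only [smul_eq_mul]
    ring
  let P := Submodule.span F (p '' blocks α)
  let Q : ℕ → Submodule F (Matrix (Fin d) (Fin d) F)[X] := fun n =>
    Submodule.span F {r | ∃ w ∈ blockPow α n, Gen.x ∈ w ∧ Interpolates r w fun t => N t ^ n}
  have hPpow : ∀ n, P ^ n ≤ Submodule.span F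
      {r | ∃ w ∈ blockPow α n, Interpolates r w fun t => N t ^ n} := by
    intro n
    induction n with
    | zero =>
      rw [pow_zero, Submodule.one_le]
      refine Submodule.subset_span ⟨[], rfl, fun t => ?_⟩
      ext i j
      rw [eval_one]
      simp only [matCoeff, pow_zero, Matrix.map_apply, Matrix.one_apply]
      split_ifs
      · rw [← word_nil, wordCoeff_word, if_pos rfl]
      · rw [map_zero]
    | succ n ih =>
      rw [pow_succ']
      refine (mul_le_mul' le_rfl ih).trans ?_
      rw [Submodule.span_mul_span]
      refine Submodule.span_mono ?_
      rintro _ ⟨_, ⟨u, hu, rfl⟩, r, ⟨v, hv, hr⟩, rfl⟩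
      exact ⟨u ++ v, ⟨u, hu, v, hv, rfl⟩, (hp u).mul_pow hNB hu hv hr⟩
  have hPQ : ∀ n, P * Q n ≤ Q (n + 1) := fun n => by
    rw [Submodule.span_mul_span]
    refine Submodule.span_mono ?_
    rintro _ ⟨_, ⟨u, hu, rfl⟩, r, ⟨v, hv, hx, hr⟩, rfl⟩
    exact ⟨u ++ v, ⟨u, hu, v, hv, rfl⟩, List.mem_append_right u hx, (hp u).mul_pow hNB hu hv hr⟩
  have hT : ∀ n, ∀ w ∈ blockPow α n, ∃ r ∈ P ^ n, Interpolates r w fun t => N t ^ n := by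
    intro n
    induction n with
    | zero =>
      rintro _ rfl
      refine ⟨1, by rw [pow_zero]; exact Submodule.one_le.1 le_rfl, fun t => ?_⟩
      ext i j
      rw [eval_one]
      simp only [matCoeff, pow_zero, Matrix.map_apply, Matrix.one_apply]
      split_ifs
      · rw [← word_nil, wordCoeff_word, if_pos rfl]
      · rw [map_zero]
    | succ n ih =>
      rintro _ ⟨u, hu, v, hv, rfl⟩
      obtain ⟨r, hr, hr'⟩ := ih v hv
      refine ⟨p u * r, ?_, (hp u).mul_pow hNB hu hv hr'⟩
      rw [pow_succ']
      exact Submodule.mul_mem_mul (Submodule.subset_span ⟨u, hu, rfl⟩) hr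
  let Px := Submodule.span F (p '' {w | w ∈ blocks α ∧ Gen.x ∈ w})
  have hPxP : Px ≤ P := Submodule.span_mono (Set.image_mono fun w hw => hw.1)
  -- As `γ_0` is the identity, the constant term of `p w` is the combination of the `A i` with the
  -- coefficients of `w` in the `a i`. Words containing `x` already separate the `a i`, so some
  -- combination of them isolates `A 0`.
  obtain ⟨q, hq, hq0⟩ : ∃ q ∈ Px, q.coeff 0 = A 0 := by
    have htop := span_wordCoeff_eq_top hlin {w | w ∈ blocks α ∧ Gen.x ∈ w} fun i => by
      rw [mem_wordSpan]
      intro w hw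
      by_cases hb : w ∈ blocks α
      · exact wordCoeff_eq_zero_of_mem_idealX (ha i).2 fun hx => hw ⟨hb, hx⟩
      · exact mem_wordSpan.1 (haB i) w hb
    let Λ : (Fin (ξ + 1) → F) →ₗ[F] Matrix (Fin d) (Fin d) F := Fintype.linearCombination F A
    have hmap : Submodule.map ((lcoeff (Matrix (Fin d) (Fin d) F) 0).restrictScalars F) Px =
        Submodule.map Λ ⊤ := by
      rw [← htop, Submodule.map_span, Submodule.map_span, ← Set.image_comp, ← Set.image_comp]
      congr 1
      refine Set.image_congr fun w _ => ?_
      simp [Λ, Fintype.linearCombination_apply, hcoeff, hc0]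
    have hmem : A 0 ∈ Submodule.map Λ ⊤ :=
      ⟨Pi.single 0 1, trivial, by simp [Λ, Fintype.linearCombination_apply_single]⟩
    rw [← hmap] at hmem
    exact hmem
  have hqQ : ∀ n, ∀ v ∈ P ^ n, q * v ∈ Q (n + 1) := by
    intro n v hv
    have hle : Px * P ^ n ≤ Q (n + 1) := by
      refine (mul_le_mul' le_rfl (hPpow n)).trans ?_
      rw [Submodule.span_mul_span]
      refine Submodule.span_mono ?_
      rintro _ ⟨_, ⟨u, hu, rfl⟩, r, ⟨v, hv, hr⟩, rfl⟩
      exact ⟨u ++ v, ⟨u, hu.1, v, hv, rfl⟩, List.mem_append_left v hu.2,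
        (hp u).mul_pow hNB hu.1 hv hr⟩
    exact hle (Submodule.mul_mem_mul hq hv)
  have hHW : H.toSubmodule * W ≤ W := Submodule.mul_le.2 hrad.mul_left_mem
  have hHH : H.toSubmodule * H.toSubmodule ≤ H.toSubmodule :=
    Submodule.mul_le.2 fun _ h1 _ h2 => H.mul_mem h1 h2
  -- The descent from layer `i` to `i + 1` is `r - r * A 0 ∈ W`, and the last layer vanishes because
  -- `W ^ s = ⊥`.
  obtain ⟨b, hb⟩ := exists_pow_le_sup (H := H.toSubmodule) (U := fun i => W ^ i * H.toSubmodule)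
    (e := A 0) (s := s) (K := K) he (hAH 0) (fun _ h1 _ h2 => H.mul_mem h1 h2) (by simp)
    (by simp [hs])
    (fun i r hr u hu => pow_mul_radical_le hHW hHH i (Submodule.mul_mem_mul hr hu))
    (fun i r hr u hu => by
      rw [pow_succ', mul_assoc]
      exact Submodule.mul_mem_mul (hW r hr).2 hu)
    (P := P)
    (by
      refine Submodule.span_le.2 ?_
      rintro _ ⟨w, -, rfl⟩ k
      rw [hcoeff]
      split_ifs
      · exact Submodule.sum_mem _ fun i _ => Submodule.smul_mem _ _ (hAH i)
      · exact Submodule.zero_mem _)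
    (by
      refine Submodule.span_le.2 ?_
      rintro _ ⟨w, -, rfl⟩
      refine mem_polysLT.2 fun k hk => ?_
      rw [hcoeff, if_neg (by omega)])
    (hPxP hq) hq0 hPQ hqQ
  refine ⟨b, fun c => ?_⟩
  obtain ⟨m, hcm, D, hDfin, hDb, hD⟩ := hb c
  obtain ⟨h1, h2⟩ := finrank_algR_inf_le hNB (hT m) (hD.trans (sup_le_sup
    (Submodule.span_mono fun r ⟨w, _, hx, hr⟩ => ⟨w, hx, hr⟩) le_rfl))
  exact ⟨m, hcm, h1, h2.trans hDb⟩

end IdempotentPresentation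

end DiffPoly

theorem mainTheorem7 {F : Type*} [Field F] [Infinite F] {d : ℕ}
    (M : Matrix (Fin d) (Fin d) (DiffPoly.FreeAlg F))
    (hM : DiffPoly.HasIdempotentPresentation M) (c : ℕ) :
    ∃ m : ℕ, c < m ∧
      FiniteDimensional F
        ↥((DiffPoly.algR F).toSubmodule ⊓ DiffPoly.spaceS (DiffPoly.spaceL (M ^ m))) ∧
      (Module.finrank F
        ↥((DiffPoly.algR F).toSubmodule ⊓ DiffPoly.spaceS (DiffPoly.spaceL (M ^ m))) : ℝ)
        < Real.sqrt (m : ℝ) := by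
  obtain ⟨b, hb⟩ := hM.exists_finrank_le
  -- The bound `b` does not depend on `m`, so `m` may be taken beyond `b ^ 2`.
  obtain ⟨m, hm, hfin, hle⟩ := hb (max c (b ^ 2))
  refine ⟨m, (le_max_left _ _).trans_lt hm, hfin, Real.lt_sqrt_of_sq_lt ?_⟩
  have h1 : b ^ 2 < m := (le_max_right _ _).trans_lt hm
  exact_mod_cast (Nat.pow_le_pow_left hle 2).trans_lt h1
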